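/- Let $E_{10}$ be the Kac--Moody Lie algebra over $\mathbb{C}$ of the Dynkin diagram with nodes $-1,0,1,\dots,8$, in which $-1,0,1,\dots,7$ form a chain (in this order) and the node $8$ is joined to the node $5$ only. Write the elements of the dual of its (real) Cartan subalgebra as $\alpha=(n_1,\dots,n_{10})\in\mathbb{R}^{10}$, with inner product $$(\alpha,\alpha')=\sum_{i=1}^{10}n_in_i'-\tfrac19\Bigl(\sum_{i=1}^{10}n_i\Bigr)\Bigl(\sum_{i=1}^{10}n_i'\Bigr),\qquad \alpha^2=(\alpha,\alpha),$$ in such coordinates that the simple roots are $\alpha_{-1}=(1,-1,0,\dots,0)$, $\alpha_0=(0,1,-1,0,\dots,0)$, $\dots$, $\alpha_7=(0,\dots,0,1,-1)$ and $\alpha_8=(0,\dots,0,1,1,1)$. Let $\Gamma=\sum_i\mathbb{Z}\alpha_i$ be the root lattice, and let $W$ be the Weyl group, generated by the reflections $\lambda\mapsto\lambda-(\lambda,\alpha_i)\alpha_i$. A positive imaginary root is a root $\gamma$ of $E_{10}$ that is a combination of the simple roots with nonnegative integer coefficients and satisfies $\gamma^2\le 0$. **Proposition.** For every positive imaginary root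 $\gamma$ of $E_{10}$ there is exactly one $\alpha=(n_1,\dots,n_{10})\in\Gamma$ with $\gamma=w(\alpha)$ for some $w\in W$ and $$0\le n_1\le n_2\le\cdots\le n_{10},\qquad 2(n_8+n_9+n_{10})\le n_1+n_2+\cdots+n_7 .$$ Moreover, for this $\alpha$ one has $n_1>0$ if and only if $\gamma^2<0$. -/

import Mathlib

namespace E10

noncomputable section

/-- The Cartan matrix of the Dynkin diagram of `E₁₀`.  The nodes, called
`-1, 0, 1, …, 8` in the usual notation, are numbered `0, …, 9` here: the nodes `0 – 1 – ⋯ – 8`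
form a chain and the node `9` is joined to the node `6` of this chain. -/
def cartanMatrix : Matrix (Fin 10) (Fin 10) ℤ :=
  !![ 2, -1,  0,  0,  0,  0,  0,  0,  0,  0;
     -1,  2, -1,  0,  0,  0,  0,  0,  0,  0;
      0, -1,  2, -1,  0,  0,  0,  0,  0,  0;
      0,  0, -1,  2, -1,  0,  0,  0,  0,  0;
      0,  0,  0, -1,  2, -1,  0,  0,  0,  0;
      0,  0,  0,  0, -1,  2, -1,  0,  0,  0;
      0,  0,  0,  0,  0, -1,  2, -1,  0, -1;
      0,  0,  0,  0,  0,  0, -1,  2, -1,  0;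
      0,  0,  0,  0,  0,  0,  0, -1,  2,  0;
      0,  0,  0,  0,  0,  0, -1,  0,  0,  2]

/-- The Kac–Moody Lie algebra `E₁₀` over `ℂ`: generators `Hᵢ`, `Eᵢ`, `Fᵢ` and the
Chevalley–Serre relations of the Cartan matrix.  (The Cartan matrix is invertible, so the
Cartan subalgebra is spanned by the simple coroots `Hᵢ`.) -/
abbrev KacMoodyAlgebra : Type := Matrix.ToLieAlgebra ℂ cartanMatrix

/-- The generator `Hᵢ`, that is the simple coroot `αᵢ^∨`, as an element of the algebra. -/
def coroot (i : Fin 10) : KacMoodyAlgebra :=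
  LieSubmodule.Quotient.mk (N := CartanMatrix.Relations.toIdeal ℂ cartanMatrix)
    (FreeLieAlgebra.of ℂ (CartanMatrix.Generators.H i))

/-- The (real) dual of the Cartan subalgebra, in coordinates `(n₁, …, n₁₀)`.
The coordinate `n_k` is `α (k - 1)`. -/
abbrev Weight : Type := Fin 10 → ℝ

/-- The invariant inner product on weights,
`(n, n') = ∑ᵢ nᵢ n'ᵢ - (1/9) (∑ᵢ nᵢ) (∑ᵢ n'ᵢ)`. -/
def form : LinearMap.BilinForm ℝ Weight :=
  LinearMap.mk₂ ℝ (fun a b : Weight => ∑ i, a i * b i - (1 / 9) * (∑ i, a i) * (∑ i, b i))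
    (fun a a' b => by
      simp only [Pi.add_apply, add_mul, Finset.sum_add_distrib]; ring)
    (fun c a b => by
      simp only [Pi.smul_apply, smul_eq_mul, mul_assoc, ← Finset.mul_sum]; ring)
    (fun a b b' => by
      simp only [Pi.add_apply, mul_add, Finset.sum_add_distrib]; ring)
    (fun c a b => by
      simp only [Pi.smul_apply, smul_eq_mul, mul_left_comm _ c, ← Finset.mul_sum]; ring)

/-- The coordinates of the simple roots `α₋₁, α₀, …, α₈`. -/
def simpleRootCoord : Fin 10 → Fin 10 → ℤ :=
  ![![1, -1,  0,  0,  0,  0,  0,  0,  0,  0],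
    ![0,  1, -1,  0,  0,  0,  0,  0,  0,  0],
    ![0,  0,  1, -1,  0,  0,  0,  0,  0,  0],
    ![0,  0,  0,  1, -1,  0,  0,  0,  0,  0],
    ![0,  0,  0,  0,  1, -1,  0,  0,  0,  0],
    ![0,  0,  0,  0,  0,  1, -1,  0,  0,  0],
    ![0,  0,  0,  0,  0,  0,  1, -1,  0,  0],
    ![0,  0,  0,  0,  0,  0,  0,  1, -1,  0],
    ![0,  0,  0,  0,  0,  0,  0,  0,  1, -1],
    ![0,  0,  0,  0,  0,  0,  0,  1,  1,  1]]

/-- The simple roots `α₋₁, α₀, …, α₈`. -/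
def simpleRoot (i : Fin 10) : Weight := fun k => (simpleRootCoord i k : ℝ)

/-- The value `l (αᵢ^∨)` of a weight `l` on the simple coroot `αᵢ^∨`.  As every `αᵢ` has square
`2`, it is `(αᵢ, l)`; the next lemma checks that `αⱼ (αᵢ^∨) = aᵢⱼ`. -/
def evalCoroot (i : Fin 10) : Module.Dual ℝ Weight := form (simpleRoot i)

theorem evalCoroot_simpleRoot (i j : Fin 10) :
    evalCoroot i (simpleRoot j) = (cartanMatrix i j : ℝ) := by
  have h : ∀ i j : Fin 10, 9 * (∑ k, simpleRootCoord i k * simpleRootCoord j k) -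
      (∑ k, simpleRootCoord i k) * (∑ k, simpleRootCoord j k) = 9 * cartanMatrix i j := by
    decide
  have h' : (9 : ℝ) * (∑ k, (simpleRootCoord i k : ℝ) * (simpleRootCoord j k : ℝ)) -
      (∑ k, (simpleRootCoord i k : ℝ)) * (∑ k, (simpleRootCoord j k : ℝ)) =
        9 * (cartanMatrix i j : ℝ) := by
    exact_mod_cast h i j
  simp only [evalCoroot, form, simpleRoot, LinearMap.mk₂_apply]
  linarith

theorem evalCoroot_self (i : Fin 10) : evalCoroot i (simpleRoot i) = 2 := by
  rw [evalCoroot_simpleRoot]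
  fin_cases i <;> simp [cartanMatrix]

/-- The simple reflection `rᵢ (l) = l - l (αᵢ^∨) αᵢ`. -/
def simpleReflection (i : Fin 10) : Weight ≃ₗ[ℝ] Weight :=
  Module.reflection (evalCoroot_self i)

/-- The Weyl group. -/
def weylGroup : Subgroup (Weight ≃ₗ[ℝ] Weight) :=
  Subgroup.closure (Set.range simpleReflection)

/-- The set of all `x` in the algebra with `[h, x] = l (h) x` for all `h` in the Cartan subalgebra
(equivalently, for all `h` in its basis of simple coroots). -/
def rootSpace (l : Weight) : Set KacMoodyAlgebra :=
  {x | ∀ i, ⁅coroot i, x⁆ = ((evalCoroot i l : ℝ) : ℂ) • x}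

/-- The set of roots. -/
def roots : Set Weight :=
  {l | l ≠ 0 ∧ ∃ x ∈ rootSpace l, x ≠ 0}

/-- The root lattice: all integer combinations of the simple roots. -/
def rootLattice : AddSubgroup Weight :=
  AddSubgroup.closure (Set.range simpleRoot)

/-- All combinations of the simple roots with nonnegative integer coefficients. -/
def rootCone : AddSubmonoid Weight :=
  AddSubmonoid.closure (Set.range simpleRoot)

/-- The positive imaginary roots. -/
def posImaginaryRoots : Set Weight :=
  {l | l ∈ roots ∧ l ∈ rootCone ∧ form l l ≤ 0}

/-- `α = (n₁, …, n₁₀)` lies in the root lattice, `0 ≤ n₁ ≤ n₂ ≤ ⋯ ≤ n₁₀`, and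
`2 (n₈ + n₉ + n₁₀) ≤ n₁ + ⋯ + n₇`. -/
def IsReduced (α : Weight) : Prop :=
  α ∈ rootLattice ∧ 0 ≤ α 0 ∧ Monotone α ∧
    2 * (α 7 + α 8 + α 9) ≤ α 0 + α 1 + α 2 + α 3 + α 4 + α 5 + α 6

end

end E10

namespace E10

open Relation

/-! The inequalities of `IsReduced` say that all pairings with simple coroots are nonpositive,
together with `0 ≤ n₁`, which is automatic in the forward light cone. So the claim is that a Weyl
orbit in the cone meets the antidominant chamber exactly once. This is proved by rewriting: reflect
in a simple root whenever its pairing is positive (`Descends`). Such a step lowers the height by a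
positive integer, and the height is nonnegative on the cone, so the process terminates. It is
locally confluent by the rank-two braid relations, hence confluent by Newman's lemma. Normal forms
are the reduced weights, and Weyl-equivalent weights have a common descendant. For the last claim,
`n₁ = 0` makes the form nonnegative by Cauchy–Schwarz. If `n₁ > 0`, the square is a positive
combination of nonpositive pairings, not all zero. -/

/-- **Newman's lemma**: a terminating, locally confluent relation is confluent. -/
theorem join_of_locally_confluent {X : Type*} {r : X → X → Prop}
    (hwf : WellFounded (flip r))
    (hlc : ∀ a b c, r a b → r a c → Join (ReflTransGen r) b c)
    {a b c : X} (hb : ReflTransGen r a b) (hc : ReflTransGen r a c) :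
    Join (ReflTransGen r) b c := by
  induction a using hwf.induction generalizing b c with
  | _ a ih =>
    rcases hb.cases_head with rfl | ⟨b', hab, hb'⟩
    · exact ⟨c, hc, .refl⟩
    rcases hc.cases_head with rfl | ⟨c', hac, hc'⟩
    · exact ⟨b, .refl, .head hab hb'⟩
    obtain ⟨d, hbd, hcd⟩ := hlc a b' c' hab hac
    obtain ⟨e, hbe, hde⟩ := ih b' hab hb' hbd
    obtain ⟨f, hef, hcf⟩ := ih c' hac (hcd.trans hde) hc'
    exact ⟨f, hbe.trans hef, hcf⟩

/-! ### The form, reflections and height -/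

theorem form_apply (a b : Weight) :
    form a b = ∑ i, a i * b i - (1 / 9) * (∑ i, a i) * (∑ i, b i) := rfl

theorem form_comm (a b : Weight) : form a b = form b a := by
  simp only [form_apply, mul_comm (a _)]
  ring

theorem simpleReflection_apply (i : Fin 10) (x : Weight) :
    simpleReflection i x = x - evalCoroot i x • simpleRoot i :=
  Module.reflection_apply _ _

theorem simpleReflection_involutive (i : Fin 10) (x : Weight) :
    simpleReflection i (simpleReflection i x) = x :=
  Module.involutive_reflection (evalCoroot_self i) x

theorem form_simpleReflection (i : Fin 10) (x : Weight) :
    form (simpleReflection i x) (simpleReflection i x) = form x x := by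
  have h1 : form (simpleRoot i) (simpleRoot i) = 2 := evalCoroot_self i
  have h2 : form x (simpleRoot i) = evalCoroot i x := form_comm _ _
  have h3 : form (simpleRoot i) x = evalCoroot i x := rfl
  simp only [simpleReflection_apply, map_sub, map_smul, LinearMap.sub_apply,
    LinearMap.smul_apply, smul_eq_mul, h1, h2, h3]
  ring

theorem form_weylGroup {w : Weight ≃ₗ[ℝ] Weight} (hw : w ∈ weylGroup) (x : Weight) :
    form (w x) (w x) = form x x := by
  induction hw using Subgroup.closure_induction generalizing x with
  | mem w hw => obtain ⟨i, rfl⟩ := hw; exact form_simpleReflection i x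
  | one => rfl
  | mul u v _ _ hu hv => exact (hu (v x)).trans (hv x)
  | inv u _ hu =>
    have h : u (u⁻¹ x) = x := u.apply_symm_apply x
    simpa [h] using (hu (u⁻¹ x)).symm

/-- The pairings of a weight with the simple coroots in coordinates. -/
theorem evalCoroot_coord (x : Weight) :
    evalCoroot 0 x = x 0 - x 1 ∧ evalCoroot 1 x = x 1 - x 2 ∧ evalCoroot 2 x = x 2 - x 3 ∧
    evalCoroot 3 x = x 3 - x 4 ∧ evalCoroot 4 x = x 4 - x 5 ∧ evalCoroot 5 x = x 5 - x 6 ∧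
    evalCoroot 6 x = x 6 - x 7 ∧ evalCoroot 7 x = x 7 - x 8 ∧ evalCoroot 8 x = x 8 - x 9 ∧
    evalCoroot 9 x = x 7 + x 8 + x 9 - (1 / 3) * ∑ i, x i := by
  refine ⟨?_, ?_, ?_, ?_, ?_, ?_, ?_, ?_, ?_, ?_⟩ <;>
    simp [evalCoroot, form_apply, simpleRoot, simpleRootCoord, Fin.sum_univ_succ] <;> ring

/-- The coefficient sum of a weight with respect to the simple roots. -/
noncomputable def height (x : Weight) : ℝ :=
  7 * x 0 + 6 * x 1 + 5 * x 2 + 4 * x 3 + 3 * x 4 + 2 * x 5 + x 6 - x 8 - 2 * x 9 +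
    (4 / 3) * ∑ i, x i

theorem height_sub_smul_simpleRoot (i : Fin 10) (x : Weight) (c : ℝ) :
    height (x - c • simpleRoot i) = height x - c := by
  fin_cases i <;>
    simp [height, simpleRoot, simpleRootCoord, Fin.sum_univ_succ] <;> ring

/-! ### The forward light cone -/

/-- The weights of the root lattice in the closed forward light cone. -/
def forwardLattice : Set Weight :=
  {x | x ∈ rootLattice ∧ form x x ≤ 0 ∧ 0 ≤ ∑ i, x i}

/-- The Cauchy–Schwarz inequality on a set of at most nine coordinates of a vector in the
forward light cone. -/
theorem abs_sum_le_of_form_nonpos {x : Weight} (hx : form x x ≤ 0) (hs : 0 ≤ ∑ i, x i)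
    (s : Finset (Fin 10)) (c : ℝ) (hc : 0 ≤ c) (hsc : (s.card : ℝ) ≤ 9 * c ^ 2) :
    |∑ i ∈ s, x i| ≤ c * ∑ i, x i := by
  have h1 : (∑ i ∈ s, x i) ^ 2 ≤ s.card * ∑ i ∈ s, x i ^ 2 := sq_sum_le_card_mul_sum_sq
  have h2 : ∑ i ∈ s, x i ^ 2 ≤ ∑ i, x i ^ 2 :=
    Finset.sum_le_sum_of_subset_of_nonneg s.subset_univ fun i _ _ => sq_nonneg _
  -- This is `form x x ≤ 0` rewritten.
  have h3 : 9 * ∑ i, x i ^ 2 ≤ (∑ i, x i) ^ 2 := by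
    rw [form_apply] at hx
    simp only [← sq] at hx
    nlinarith
  have h0 : 0 ≤ ∑ i ∈ s, x i ^ 2 := Finset.sum_nonneg fun i _ => sq_nonneg _
  refine abs_le_of_sq_le_sq ?_ (by positivity)
  calc (∑ i ∈ s, x i) ^ 2 ≤ s.card * ∑ i ∈ s, x i ^ 2 := h1
    _ ≤ 9 * c ^ 2 * ∑ i ∈ s, x i ^ 2 := by gcongr
    _ ≤ 9 * c ^ 2 * ∑ i, x i ^ 2 := by gcongr
    _ ≤ (c * ∑ i, x i) ^ 2 := by nlinarith [sq_nonneg c]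

/-- A vector in the forward light cone has nonnegative first coordinate. -/
theorem coord_zero_nonneg {x : Weight} (hx : form x x ≤ 0) (hs : 0 ≤ ∑ i, x i) : 0 ≤ x 0 := by
  have h := (abs_le.1 (abs_sum_le_of_form_nonpos hx hs (Finset.univ.erase 0) 1 one_pos.le
    (by simp))).2
  have := Finset.add_sum_erase Finset.univ x (Finset.mem_univ 0)
  linarith

/-- By Abel summation the height is `25/3` of the total minus the nine proper tail sums, which are
together at most `7 + 2/3 + 1/3 = 8` times the total. -/
theorem height_nonneg {x : Weight} (hx : form x x ≤ 0) (hs : 0 ≤ ∑ i, x i) : 0 ≤ height x := by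
  have key := fun s hs' => (abs_le.1 (abs_sum_le_of_form_nonpos hx hs s 1 one_pos.le hs')).2
  have h1 := key {1, 2, 3, 4, 5, 6, 7, 8, 9} (by simp)
  have h2 := key {2, 3, 4, 5, 6, 7, 8, 9} (by simp; norm_num)
  have h3 := key {3, 4, 5, 6, 7, 8, 9} (by simp; norm_num)
  have h4 := key {4, 5, 6, 7, 8, 9} (by simp; norm_num)
  have h5 := key {5, 6, 7, 8, 9} (by simp; norm_num)
  have h6 := key {6, 7, 8, 9} (by simp; norm_num)
  have h7 := key {7, 8, 9} (by simp; norm_num)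
  have h8 := (abs_le.1 (abs_sum_le_of_form_nonpos hx hs {8, 9} (2 / 3) (by norm_num)
    (by simp; norm_num))).2
  have h9 := (abs_le.1 (abs_sum_le_of_form_nonpos hx hs {9} (1 / 3) (by norm_num)
    (by simp; norm_num))).2
  simp [Fin.sum_univ_succ] at *
  simp [height, Fin.sum_univ_succ]
  linarith

/-- Only node `9` changes the total `S`, to `2S - 3 (x 7 + x 8 + x 9)`; the three coordinates sum to
at most `2S/3`. -/
theorem sum_simpleReflection_nonneg (i : Fin 10) {x : Weight} (hx : form x x ≤ 0)
    (hs : 0 ≤ ∑ k, x k) : 0 ≤ ∑ k, simpleReflection i x k := by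
  have hsum : ∑ k, simpleReflection i x k =
      ∑ k, x k - evalCoroot i x * ∑ k, simpleRoot i k := by
    simp [simpleReflection_apply, Finset.sum_sub_distrib, Finset.mul_sum]
  obtain rfl | hi := eq_or_ne i 9
  · have h := (abs_le.1 (abs_sum_le_of_form_nonpos hx hs {7, 8, 9} (2 / 3) (by norm_num)
      (by simp; norm_num))).2
    have h3 : ∑ k, simpleRoot 9 k = 3 := by
      simp [simpleRoot, simpleRootCoord, Fin.sum_univ_succ]; norm_num
    rw [hsum, h3, (evalCoroot_coord x).2.2.2.2.2.2.2.2.2]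
    simp only [Finset.sum_insert, Finset.mem_insert, Finset.mem_singleton, Fin.reduceEq,
      or_self, not_false_eq_true, Finset.sum_singleton] at h
    linarith
  · have h0 : ∑ k, simpleRoot i k = 0 := by
      have h : ∀ i : Fin 10, i ≠ 9 → ∑ k, simpleRootCoord i k = 0 := by decide
      have := h i hi
      simp only [simpleRoot]
      exact_mod_cast this
    rw [hsum, h0]
    linarith

theorem exists_int_evalCoroot (i : Fin 10) {x : Weight} (hx : x ∈ rootLattice) :
    ∃ m : ℤ, evalCoroot i x = m := by
  induction hx using AddSubgroup.closure_induction with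
  | mem x hx =>
    obtain ⟨j, rfl⟩ := hx
    exact ⟨_, evalCoroot_simpleRoot i j⟩
  | zero => exact ⟨0, by simp⟩
  | add x y _ _ hx hy =>
    obtain ⟨m, hm⟩ := hx
    obtain ⟨n, hn⟩ := hy
    exact ⟨m + n, by simp [hm, hn]⟩
  | neg x _ hx =>
    obtain ⟨m, hm⟩ := hx
    exact ⟨-m, by simp [hm]⟩

theorem simpleReflection_mem_forwardLattice (i : Fin 10) {x : Weight}
    (hx : x ∈ forwardLattice) : simpleReflection i x ∈ forwardLattice := by
  obtain ⟨hl, hf, hs⟩ := hx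
  refine ⟨?_, (form_simpleReflection i x).trans_le hf, sum_simpleReflection_nonneg i hf hs⟩
  obtain ⟨m, hm⟩ := exists_int_evalCoroot i hl
  rw [simpleReflection_apply, hm, Int.cast_smul_eq_zsmul]
  exact sub_mem hl (zsmul_mem (AddSubgroup.subset_closure (Set.mem_range_self i)) m)

/-! ### Descent: termination and confluence -/

/-- A step of the reduction: a reflection of a weight of the forward light cone that lowers
its height. -/
def Descends (x y : Weight) : Prop :=
  x ∈ forwardLattice ∧ ∃ i, 0 < evalCoroot i x ∧ y = simpleReflection i x

theorem descends_wellFounded : WellFounded (flip Descends) := by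
  refine Subrelation.wf ?_ (measure fun x => ⌊height x⌋₊).wf
  rintro y x ⟨hx, i, hi, rfl⟩
  obtain ⟨m, hm⟩ := exists_int_evalCoroot i hx.1
  have hm1 : (1 : ℝ) ≤ evalCoroot i x := by
    rw [hm] at hi ⊢
    exact_mod_cast hi
  have hy := simpleReflection_mem_forwardLattice i hx
  have h0 := height_nonneg hy.2.1 hy.2.2
  have he : height (simpleReflection i x) = height x - evalCoroot i x := by
    rw [simpleReflection_apply, height_sub_smul_simpleRoot]
  change ⌊height (simpleReflection i x)⌋₊ < ⌊height x⌋₊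
  rw [Nat.lt_iff_add_one_le, Nat.le_floor_iff (by linarith)]
  push_cast
  linarith [Nat.floor_le h0]

theorem evalCoroot_simpleReflection (i j : Fin 10) (x : Weight) :
    evalCoroot i (simpleReflection j x) =
      evalCoroot i x - evalCoroot j x * (cartanMatrix i j : ℝ) := by
  rw [simpleReflection_apply, map_sub, map_smul, evalCoroot_simpleRoot, smul_eq_mul]

/-- Two simple reflections either commute or satisfy the braid relation, so the two sides meet after
one or two further steps. With `a`, `b` the pairings at `x`, the braid case pairs successively to `a
+ b` and then to `b` (or `a`), all positive. -/
theorem descends_locally_confluent (x y z : Weight) (hy : Descends x y) (hz : Descends x z) :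
    Join (ReflTransGen Descends) y z := by
  obtain ⟨hx, i, hi, rfl⟩ := hy
  obtain ⟨-, j, hj, rfl⟩ := hz
  obtain rfl | hij := eq_or_ne i j
  · exact ⟨_, .refl, .refl⟩
  have hsymm : cartanMatrix.transpose = cartanMatrix := by decide
  have hoff : ∀ i j : Fin 10, i ≠ j → cartanMatrix i j * (cartanMatrix i j + 1) = 0 := by decide
  have hsi := simpleReflection_mem_forwardLattice i hx
  have hsj := simpleReflection_mem_forwardLattice j hx
  have hii : ∀ i : Fin 10, cartanMatrix i i = 2 := by decide
  rcases mul_eq_zero.1 (hoff i j hij) with h | h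
  · have h' : cartanMatrix j i = 0 := (congrFun₂ hsymm i j).trans h
    refine ⟨simpleReflection j (simpleReflection i x),
      .single ⟨hsi, j, by simpa [evalCoroot_simpleReflection, h'], rfl⟩,
      .single ⟨hsj, i, by simpa [evalCoroot_simpleReflection, h], ?_⟩⟩
    rw [simpleReflection_apply j (simpleReflection i x),
      simpleReflection_apply i (simpleReflection j x), evalCoroot_simpleReflection,
      evalCoroot_simpleReflection, simpleReflection_apply, simpleReflection_apply, h, h']
    module
  · replace h := eq_neg_of_add_eq_zero_left h
    have h' : cartanMatrix j i = -1 := (congrFun₂ hsymm i j).trans h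
    have hji := simpleReflection_mem_forwardLattice j hsi
    have hij := simpleReflection_mem_forwardLattice i hsj
    refine ⟨simpleReflection i (simpleReflection j (simpleReflection i x)),
      .head ⟨hsi, j, ?_, rfl⟩ (.single ⟨hji, i, ?_, rfl⟩),
      .head ⟨hsj, i, ?_, rfl⟩ (.single ⟨hij, j, ?_, ?_⟩)⟩
    · simp only [evalCoroot_simpleReflection, h']; push_cast; linarith
    · simp only [evalCoroot_simpleReflection, h, h', hii]; push_cast; linarith
    · simp only [evalCoroot_simpleReflection, h]; push_cast; linarith
    · simp only [evalCoroot_simpleReflection, h, h', hii]; push_cast; linarith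
    · rw [simpleReflection_apply i (simpleReflection j _),
        simpleReflection_apply j (simpleReflection i (simpleReflection j x)),
        simpleReflection_apply j (simpleReflection i x),
        simpleReflection_apply i (simpleReflection j x)]
      simp only [map_sub, map_smul, evalCoroot_simpleRoot, simpleReflection_apply, h, h', hii,
        smul_eq_mul]
      push_cast
      module

/-- Confluence makes joinability transitive, which handles products. Membership is an equivalence so
that inverses go through. -/
theorem weylGroup_join {w : Weight ≃ₗ[ℝ] Weight} (hw : w ∈ weylGroup) (x : Weight) :
    (x ∈ forwardLattice ↔ w x ∈ forwardLattice) ∧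
      (x ∈ forwardLattice → Join (ReflTransGen Descends) x (w x)) := by
  induction hw using Subgroup.closure_induction generalizing x with
  | mem w hw =>
    obtain ⟨i, rfl⟩ := hw
    refine ⟨⟨simpleReflection_mem_forwardLattice i, fun h => ?_⟩, fun hx => ?_⟩
    · simpa only [simpleReflection_involutive] using simpleReflection_mem_forwardLattice i h
    rcases lt_trichotomy (evalCoroot i x) 0 with h | h | h
    · refine ⟨x, .refl, .single ⟨simpleReflection_mem_forwardLattice i hx, i, ?_,
        (simpleReflection_involutive i x).symm⟩⟩
      have hii : ∀ i : Fin 10, cartanMatrix i i = 2 := by decide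
      rw [evalCoroot_simpleReflection, hii]
      push_cast
      linarith
    · rw [simpleReflection_apply, h, zero_smul, sub_zero]
      exact ⟨x, .refl, .refl⟩
    · exact ⟨_, .single ⟨hx, i, h, rfl⟩, .refl⟩
  | one => exact ⟨Iff.rfl, fun _ => ⟨x, .refl, .refl⟩⟩
  | mul u v _ _ hu hv =>
    refine ⟨(hv x).1.trans (hu (v x)).1, fun hx => ?_⟩
    obtain ⟨a, hxa, hva⟩ := (hv x).2 hx
    obtain ⟨b, hvb, hub⟩ := (hu (v x)).2 ((hv x).1.1 hx)
    obtain ⟨c, hac, hbc⟩ :=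
      join_of_locally_confluent descends_wellFounded descends_locally_confluent hva hvb
    exact ⟨c, hxa.trans hac, hub.trans hbc⟩
  | inv u _ hu =>
    have h : u (u⁻¹ x) = x := u.apply_symm_apply x
    have hx := hu (u⁻¹ x)
    rw [h] at hx
    refine ⟨hx.1.symm, fun hm => ?_⟩
    obtain ⟨a, h1, h2⟩ := hx.2 (hx.1.2 hm)
    exact ⟨a, h2, h1⟩

theorem exists_weylGroup_of_descends {x y : Weight} (h : ReflTransGen Descends x y) :
    ∃ w ∈ weylGroup, x = w y := by
  induction h with
  | refl => exact ⟨1, one_mem _, rfl⟩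
  | tail _ hyz ih =>
    obtain ⟨w, hw, rfl⟩ := ih
    obtain ⟨-, i, -, rfl⟩ := hyz
    refine ⟨w * simpleReflection i, mul_mem hw (Subgroup.subset_closure ⟨i, rfl⟩), ?_⟩
    exact congrArg w (simpleReflection_involutive i _).symm

/-! ### Reduced weights as normal forms -/

theorem evalCoroot_nonpos_of_isReduced {x : Weight} (hx : IsReduced x) (i : Fin 10) :
    evalCoroot i x ≤ 0 := by
  obtain ⟨-, -, hm, h⟩ := hx
  obtain ⟨h0, h1, h2, h3, h4, h5, h6, h7, h8, h9⟩ := evalCoroot_coord x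
  have hm' : ∀ i j : Fin 10, i ≤ j → x i - x j ≤ 0 := fun i j hij => sub_nonpos.2 (hm hij)
  have h9' : evalCoroot 9 x ≤ 0 := by
    simp [h9, Fin.sum_univ_succ]
    linarith
  fin_cases i
  · exact h0.trans_le (hm' _ _ (by decide))
  · exact h1.trans_le (hm' _ _ (by decide))
  · exact h2.trans_le (hm' _ _ (by decide))
  · exact h3.trans_le (hm' _ _ (by decide))
  · exact h4.trans_le (hm' _ _ (by decide))
  · exact h5.trans_le (hm' _ _ (by decide))
  · exact h6.trans_le (hm' _ _ (by decide))
  · exact h7.trans_le (hm' _ _ (by decide))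
  · exact h8.trans_le (hm' _ _ (by decide))
  · exact h9'

theorem isReduced_of_evalCoroot_nonpos {x : Weight} (hx : x ∈ forwardLattice)
    (h : ∀ i, evalCoroot i x ≤ 0) : IsReduced x := by
  obtain ⟨h0, h1, h2, h3, h4, h5, h6, h7, h8, h9⟩ := evalCoroot_coord x
  refine ⟨hx.1, coord_zero_nonneg hx.2.1 hx.2.2, ?_, ?_⟩
  · refine Fin.monotone_iff_le_succ.2 fun i => ?_
    fin_cases i
    · exact sub_nonpos.1 (h0 ▸ h 0)
    · exact sub_nonpos.1 (h1 ▸ h 1)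
    · exact sub_nonpos.1 (h2 ▸ h 2)
    · exact sub_nonpos.1 (h3 ▸ h 3)
    · exact sub_nonpos.1 (h4 ▸ h 4)
    · exact sub_nonpos.1 (h5 ▸ h 5)
    · exact sub_nonpos.1 (h6 ▸ h 6)
    · exact sub_nonpos.1 (h7 ▸ h 7)
    · exact sub_nonpos.1 (h8 ▸ h 8)
  · have := h 9
    rw [h9] at this
    simp [Fin.sum_univ_succ] at this
    linarith

theorem IsReduced.eq_of_descends {x y : Weight} (hx : IsReduced x)
    (h : ReflTransGen Descends x y) : x = y := by
  rcases h.cases_head with h | ⟨z, ⟨-, i, hi, -⟩, -⟩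
  · exact h
  · exact absurd (evalCoroot_nonpos_of_isReduced hx i) hi.not_ge

theorem exists_isReduced {x : Weight} (hx : x ∈ forwardLattice) :
    ∃ y, IsReduced y ∧ ReflTransGen Descends x y := by
  induction x using descends_wellFounded.induction with
  | _ x ih =>
    by_cases h : ∀ i, evalCoroot i x ≤ 0
    · exact ⟨x, isReduced_of_evalCoroot_nonpos hx h, .refl⟩
    · push Not at h
      obtain ⟨i, hi⟩ := h
      have hd : Descends x (simpleReflection i x) := ⟨hx, i, hi, rfl⟩
      obtain ⟨y, hy, hxy⟩ := ih _ hd (simpleReflection_mem_forwardLattice i hx)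
      exact ⟨y, hy, .head hd hxy⟩

theorem IsReduced.descends_of_weylGroup {x α : Weight} (hx : x ∈ forwardLattice)
    (hα : IsReduced α) (h : ∃ w ∈ weylGroup, x = w α) : ReflTransGen Descends x α := by
  obtain ⟨w, hw, rfl⟩ := h
  obtain ⟨y, hy, hxy⟩ := (weylGroup_join hw α).2 ((weylGroup_join hw α).1.2 hx)
  rwa [← hα.eq_of_descends hy] at hxy

theorem mem_forwardLattice_of_mem_rootCone {x : Weight} (hx : x ∈ rootCone)
    (hf : form x x ≤ 0) : x ∈ forwardLattice := by
  refine ⟨?_, hf, ?_⟩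
  · exact AddSubmonoid.closure_le (S := rootLattice.toAddSubmonoid).2
      AddSubgroup.subset_closure hx
  · clear hf
    induction hx using AddSubmonoid.closure_induction with
    | mem x hx =>
      obtain ⟨i, rfl⟩ := hx
      have h : ∀ i : Fin 10, 0 ≤ ∑ k, simpleRootCoord i k := by decide
      have := h i
      simp only [simpleRoot]
      exact_mod_cast this
    | zero => simp
    | add x y _ _ hx hy =>
      simp only [Pi.add_apply, Finset.sum_add_distrib]
      exact add_nonneg hx hy

/-! ### The sign of the square -/

theorem form_nonneg_of_coord_zero {x : Weight} (hx : x 0 = 0) : 0 ≤ form x x := by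
  have h : (∑ i ∈ Finset.univ.erase 0, x i) ^ 2 ≤
      ((Finset.univ.erase (0 : Fin 10)).card : ℝ) * ∑ i ∈ Finset.univ.erase 0, x i ^ 2 :=
    sq_sum_le_card_mul_sum_sq
  have h1 := Finset.add_sum_erase Finset.univ x (Finset.mem_univ 0)
  have h2 := Finset.add_sum_erase Finset.univ (fun i => x i ^ 2) (Finset.mem_univ 0)
  simp only [Finset.card_erase_of_mem (Finset.mem_univ _), Finset.card_univ,
    Fintype.card_fin] at h
  rw [hx] at h1
  simp only [hx] at h2
  rw [form_apply, ← h1]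
  simp only [← sq]
  rw [← h2]
  push_cast at h
  linarith

/-- The square of a weight as the sum of the products of its coefficients with respect to the
simple roots and its pairings with the simple coroots. -/
theorem form_self_eq (x : Weight) :
    form x x = x 0 * evalCoroot 0 x + (x 0 + x 1) * evalCoroot 1 x +
      (x 0 + x 1 + x 2) * evalCoroot 2 x + (x 0 + x 1 + x 2 + x 3) * evalCoroot 3 x +
      (x 0 + x 1 + x 2 + x 3 + x 4) * evalCoroot 4 x +
      (x 0 + x 1 + x 2 + x 3 + x 4 + x 5) * evalCoroot 5 x +
      (x 0 + x 1 + x 2 + x 3 + x 4 + x 5 + x 6) * evalCoroot 6 x +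
      ((2 / 3) * ∑ i, x i - x 8 - x 9) * evalCoroot 7 x +
      ((1 / 3) * ∑ i, x i - x 9) * evalCoroot 8 x +
      ((1 / 3) * ∑ i, x i) * evalCoroot 9 x := by
  obtain ⟨h0, h1, h2, h3, h4, h5, h6, h7, h8, h9⟩ := evalCoroot_coord x
  rw [h0, h1, h2, h3, h4, h5, h6, h7, h8, h9, form_apply]
  simp [Fin.sum_univ_succ]
  ring

theorem form_neg_of_isReduced {x : Weight} (hx : IsReduced x) (h0 : 0 < x 0) :
    form x x < 0 := by
  have hn := evalCoroot_nonpos_of_isReduced hx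
  have hpos : ∀ i, 0 < x i := fun i => h0.trans_le (hx.2.2.1 (Fin.zero_le i))
  have hs : ∑ i, x i = x 0 + x 1 + x 2 + x 3 + x 4 + x 5 + x 6 + x 7 + x 8 + x 9 := by
    simp [Fin.sum_univ_succ]; ring
  have h9 := hx.2.2.2
  have p0 := hpos 0
  have p1 := hpos 1
  have p2 := hpos 2
  have p3 := hpos 3
  have p4 := hpos 4
  have p5 := hpos 5
  have p6 := hpos 6
  have p7 := hpos 7
  have p8 := hpos 8
  have p9 := hpos 9
  have key : ∀ (c : ℝ) (i : Fin 10), 0 < c → c * evalCoroot i x ≤ 0 := fun c i hc =>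
    mul_nonpos_of_nonneg_of_nonpos hc.le (hn i)
  have q0 := key (x 0) 0 p0
  have q1 := key (x 0 + x 1) 1 (by linarith)
  have q2 := key (x 0 + x 1 + x 2) 2 (by linarith)
  have q3 := key (x 0 + x 1 + x 2 + x 3) 3 (by linarith)
  have q4 := key (x 0 + x 1 + x 2 + x 3 + x 4) 4 (by linarith)
  have q5 := key (x 0 + x 1 + x 2 + x 3 + x 4 + x 5) 5 (by linarith)
  have q6 := key (x 0 + x 1 + x 2 + x 3 + x 4 + x 5 + x 6) 6 (by linarith)
  have q7 := key ((2 / 3) * ∑ i, x i - x 8 - x 9) 7 (by linarith)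
  have q8 := key ((1 / 3) * ∑ i, x i - x 9) 8 (by linarith)
  have q9 := key ((1 / 3) * ∑ i, x i) 9 (by linarith)
  have he := form_self_eq x
  -- A nonnegative sum of nonpositive terms with positive coefficients forces every pairing to
  -- vanish.
  by_contra! hf
  have zero : ∀ (c : ℝ) (i : Fin 10), 0 < c → 0 ≤ c * evalCoroot i x → evalCoroot i x = 0 :=
    fun c i hc h => le_antisymm (hn i) (nonneg_of_mul_nonneg_right h hc)
  have z0 := zero (x 0) 0 p0 (by linarith)
  have z1 := zero (x 0 + x 1) 1 (by linarith) (by linarith)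
  have z2 := zero (x 0 + x 1 + x 2) 2 (by linarith) (by linarith)
  have z3 := zero (x 0 + x 1 + x 2 + x 3) 3 (by linarith) (by linarith)
  have z4 := zero (x 0 + x 1 + x 2 + x 3 + x 4) 4 (by linarith) (by linarith)
  have z5 := zero (x 0 + x 1 + x 2 + x 3 + x 4 + x 5) 5 (by linarith) (by linarith)
  have z6 := zero (x 0 + x 1 + x 2 + x 3 + x 4 + x 5 + x 6) 6 (by linarith) (by linarith)
  have z7 := zero ((2 / 3) * ∑ i, x i - x 8 - x 9) 7 (by linarith) (by linarith)
  have z8 := zero ((1 / 3) * ∑ i, x i - x 9) 8 (by linarith) (by linarith)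
  have z9 := zero ((1 / 3) * ∑ i, x i) 9 (by linarith) (by linarith)
  obtain ⟨e0, e1, e2, e3, e4, e5, e6, e7, e8, e9⟩ := evalCoroot_coord x
  -- All coordinates equal some `t` with `3t = 10t/3`, so `t = 0`, against `p0`.
  linarith

end E10

theorem mainTheorem7 (γ : E10.Weight) (hγ : γ ∈ E10.posImaginaryRoots) :
    (∃! α : E10.Weight, E10.IsReduced α ∧ ∃ w ∈ E10.weylGroup, γ = w α) ∧
    (∀ α : E10.Weight, E10.IsReduced α → (∃ w ∈ E10.weylGroup, γ = w α) →
      (0 < α 0 ↔ E10.form γ γ < 0)) := by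
  obtain ⟨-, hc, hf⟩ := hγ
  have hfl := E10.mem_forwardLattice_of_mem_rootCone hc hf
  refine ⟨?_, ?_⟩
  · obtain ⟨α, hα, hd⟩ := E10.exists_isReduced hfl
    refine ⟨α, ⟨hα, E10.exists_weylGroup_of_descends hd⟩, ?_⟩
    rintro β ⟨hβ, hw⟩
    obtain ⟨δ, h1, h2⟩ := E10.join_of_locally_confluent E10.descends_wellFounded
      E10.descends_locally_confluent hd (hβ.descends_of_weylGroup hfl hw)
    rw [hα.eq_of_descends h1, hβ.eq_of_descends h2]
  · rintro α hα ⟨w, hw, rfl⟩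
    rw [E10.form_weylGroup hw]
    refine ⟨E10.form_neg_of_isReduced hα, fun h => ?_⟩
    refine hα.2.1.lt_of_ne fun h0 => ?_
    exact absurd (E10.form_nonneg_of_coord_zero h0.symm) h.not_ge
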